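/- **Setting.** Let $\Omega\subset\mathbb R^2$ be a bounded open set (for instance a bounded Lipschitz domain), let $f\in L^2(\Omega)$, and let $u\in H^1_0(\Omega)\cap C^0(\overline\Omega)$ be the weak solution of $-\Delta u=f$, i.e. $(\nabla u,\nabla v)=(f,v)$ for all $v\in H^1_0(\Omega)$. Let $\mathcal T_h$ be a finite family of pairwise disjoint open polygons $K\subset\Omega$ with $\overline\Omega=\bigcup_{K}\overline K$; each $K$ is the bounded region enclosed by a non-self-intersecting closed polyline with vertices $\mathcal N(K)$ (angles equal to $\pi$ at a vertex are allowed) and edges $e\subset\partial K$, where $h_e$ is the length of $e$, $\boldsymbol a_e,\boldsymbol b_e$ are its end points, and $n_{\mathcal E_K}$ is the number of edges of $K$. Let $$V_K=\{v\in H^1(K):\ v|_{\partial K}\in C^0(\partial K),\ v|_e \text{ is affine for every edge } e\subset\partial K,\ \Delta v=0\text{ in }K\},$$ $$V_h=\{v\in H^1_0(\Omega):\ v|_K\in V_K\text{ for all }K\in\mathcal T_h\}.$$ For $v\in H^1(K)\cap C^0(\overline K)$ let $\Pi v\in\mathbb P_1(K)$ be defined by $(\nabla(v-\Pi v),\nabla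 p)_K=0$ for all $p\in\mathbb P_1(K)$ and $\int_{\partial K}(v-\Pi v)\,ds=0$; on $\mathcal T_h$ the operator $\Pi$ is understood elementwise. Put $$S_{\mathcal E_K}(v,w)=\sum_{e\subset\partial K}\bigl(v(\boldsymbol b_e)-v(\boldsymbol a_e)\bigr)\bigl(w(\boldsymbol b_e)-w(\boldsymbol a_e)\bigr),\qquad |v|_{\frac12,\mathcal E_K}^2=S_{\mathcal E_K}(v,v),$$ $$a_h(v,w)=\sum_{K\in\mathcal T_h}(\nabla\Pi v,\nabla\Pi w)_K+\sum_{K\in\mathcal T_h}S_{\mathcal E_K}(v-\Pi v,w-\Pi w),\qquad |||v|||=a_h(v,v)^{1/2}.$$ Let $u_h\in V_h$ satisfy $a_h(u_h,v_h)=(f,\Pi v_h)$ for all $v_h\in V_h$, and let $u_I\in V_h$ be the nodal interpolation of $u$, that is, $u_I(\boldsymbol a)=u(\boldsymbol a)$ for all $\boldsymbol a\in\mathcal N(K)$, $K\in\mathcal T_h$. Assume that on each $\partial K$ the normal derivative $\nabla(u-\Pi u)\cdot\boldsymbol n$ (in the sense of Green's formula) belongs to $L^2(\partial K)$, so that the right-hand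 side below is finite. **Claim.** There is an absolute constant $C>0$, independent of $\Omega$, $\mathcal T_h$, $f$, $u$, such that $$|||u_h-u_I|||\le C\Biggl\{\sum_{K\in\mathcal T_h}\Bigl(\|\nabla\Pi(u-u_I)\|_{0,K}^2+|u_I-\Pi u_I|_{\frac12,\mathcal E_K}^2+n_{\mathcal E_K}^2\sum_{e\subset\partial K}h_e\,\|\nabla(u-\Pi u)\cdot\boldsymbol n\|_{0,e}^2\Bigr)\Biggr\}^{1/2}.$$ -/

import Mathlib

open scoped ContDiff
open MeasureTheory

noncomputable section

namespace VEM

/-- The Euclidean plane. -/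
abbrev Plane : Type := EuclideanSpace ℝ (Fin 2)

/-! ### Sobolev spaces -/

/-- `φ ∈ C_c^∞(U)`. -/
def IsTestFunction (U : Set Plane) (φ : Plane → ℝ) : Prop :=
  ContDiff ℝ ∞ φ ∧ HasCompactSupport φ ∧ tsupport φ ⊆ U

/-- `v` lies in `L²(U)` and `G ∈ L²(U)²` is its weak gradient on the open set `U`. -/
def IsWeakGradient (U : Set Plane) (v : Plane → ℝ) (G : Plane → Plane) : Prop :=
  MemLp v 2 (volume.restrict U) ∧ MemLp G 2 (volume.restrict U) ∧
    ∀ φ : Plane → ℝ, IsTestFunction U φ → ∀ a : Plane,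
      ∫ x in U, v x * fderiv ℝ φ x a = -∫ x in U, inner ℝ (G x) a * φ x

/-- `v ∈ H¹(U)`. -/
def MemH1 (U : Set Plane) (v : Plane → ℝ) : Prop :=
  ∃ G : Plane → Plane, IsWeakGradient U v G

open Classical in
/-- The weak gradient of `v ∈ H¹(U)` (determined almost everywhere on `U`). -/
def weakGrad (U : Set Plane) (v : Plane → ℝ) : Plane → Plane :=
  if h : MemH1 U v then h.choose else 0

/-- `v ∈ H¹₀(U)`, the closure of `C_c^∞(U)` in `H¹(U)`. -/
def MemH10 (U : Set Plane) (v : Plane → ℝ) : Prop :=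
  MemH1 U v ∧ ∃ φ : ℕ → Plane → ℝ, (∀ m, IsTestFunction U (φ m)) ∧
    Filter.Tendsto (fun m => eLpNorm (fun x => v x - φ m x) 2 (volume.restrict U))
      Filter.atTop (nhds 0) ∧
    Filter.Tendsto
      (fun m => eLpNorm (fun x => weakGrad U v x - gradient (φ m) x) 2 (volume.restrict U))
      Filter.atTop (nhds 0)

/-- `u ∈ H¹₀(Ω)` is the weak solution of `-Δu = f` with zero Dirichlet data. -/
def IsWeakSolution (Ω : Set Plane) (f u : Plane → ℝ) : Prop :=
  MemH10 Ω u ∧ ∀ v : Plane → ℝ, MemH10 Ω v →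
    ∫ x in Ω, inner ℝ (weakGrad Ω u x) (weakGrad Ω v x) = ∫ x in Ω, f x * v x

/-! ### Polygons and meshes -/

/-- An open polygon with non-self-intersecting polygonal boundary: a bounded connected open set
whose boundary is a simple closed polyline.  Angles equal to `π` at a vertex (hanging nodes) are
allowed.  The condition `simple` says that the closed polyline is traversed injectively; it
forces at least three vertices and nondegenerate edges. -/
structure PolygonalElement where
  /-- the number of vertices, which is also the number of edges -/
  n : ℕ
  /-- the vertices in cyclic order; the `i`-th edge joins the `i`-th vertex to the next one -/
  poly : Polygon Plane n
  simple : ∀ i j : Fin n, ∀ s ∈ Set.Ico (0 : ℝ) 1, ∀ t ∈ Set.Ico (0 : ℝ) 1,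
    poly.edgePath ℝ i s = poly.edgePath ℝ j t → i = j ∧ s = t
  /-- the open region enclosed by the polyline -/
  carrier : Set Plane
  isOpen : IsOpen carrier
  isConnected : IsConnected carrier
  isBounded : Bornology.IsBounded carrier
  frontier_eq : frontier carrier = poly.boundary ℝ

namespace PolygonalElement

variable (K : PolygonalElement)

/-- The starting point `a_e` of the `i`-th edge. -/
def edgeStart (i : Fin K.n) : Plane := K.poly i

/-- The end point `b_e` of the `i`-th edge. -/
def edgeEnd (i : Fin K.n) : Plane := K.poly (finRotate K.n i)

/-- The length `h_e` of the `i`-th edge. -/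
def edgeLength (i : Fin K.n) : ℝ := dist (K.edgeStart i) (K.edgeEnd i)

/-- The integral of `w` with respect to arc length over the `i`-th edge. -/
def edgeIntegral (i : Fin K.n) (w : Plane → ℝ) : ℝ :=
  K.edgeLength i * ∫ t in (0 : ℝ)..1, w (K.poly.edgePath ℝ i t)

/-- The integral of `w` with respect to arc length over `∂K`. -/
def boundaryIntegral (w : Plane → ℝ) : ℝ := ∑ i, K.edgeIntegral i w

/-- `w ∈ L²(∂K)`. -/
def MemL2Boundary (w : Plane → ℝ) : Prop :=
  ∀ i : Fin K.n, MemLp (fun t : ℝ => w (K.poly.edgePath ℝ i t)) 2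
    (volume.restrict (Set.Icc (0 : ℝ) 1))

/-- `g ∈ L²(∂K)` is the outward normal derivative `∇w · n` of `w ∈ H¹(K)` on `∂K`, in the sense
of Green's formula `⟨∇w · n, φ⟩_{∂K} = (∇w, ∇φ)_K + (Δw, φ)_K`; here `d = Δw ∈ L²(K)`. The test
functions run through `H¹(K) ∩ C(K̄)`, so that their traces are their boundary values. -/
def IsNormalDerivative (w g : Plane → ℝ) : Prop :=
  MemH1 K.carrier w ∧ K.MemL2Boundary g ∧
    ∃ d : Plane → ℝ, MemLp d 2 (volume.restrict K.carrier) ∧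
      ∀ φ : Plane → ℝ, MemH1 K.carrier φ → ContinuousOn φ (closure K.carrier) →
        K.boundaryIntegral (fun x => g x * φ x) =
          (∫ x in K.carrier, inner ℝ (weakGrad K.carrier w x) (weakGrad K.carrier φ x)) +
            ∫ x in K.carrier, d x * φ x

/-- The local virtual element space `V_K`: functions in `H¹(K)`, harmonic in `K`, whose boundary
values are continuous and affine on every edge.  (Such functions are continuous on the closure
of the polygon `K`, so that their trace is given by their pointwise boundary values.) -/
def MemVK (v : Plane → ℝ) : Prop :=
  MemH1 K.carrier v ∧ InnerProductSpace.HarmonicOnNhd v K.carrier ∧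
    ContinuousOn v (closure K.carrier) ∧
    ∀ i : Fin K.n, ∀ t ∈ Set.Icc (0 : ℝ) 1,
      v (K.poly.edgePath ℝ i t) = (1 - t) * v (K.edgeStart i) + t * v (K.edgeEnd i)

/-- The affine polynomial `q` satisfies the two conditions that define the local projection of
`w`: `(∇(w - q), ∇p)_K = 0` for all `p ∈ ℙ₁(K)`, and `∫_{∂K} (w - q) ds = 0`. -/
def IsProj (w : Plane → ℝ) (q : Plane →ᵃ[ℝ] ℝ) : Prop :=
  (∀ p : Plane →ᵃ[ℝ] ℝ,
    ∫ x in K.carrier, inner ℝ (weakGrad K.carrier w x - gradient q x) (gradient p x) = 0) ∧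
  K.boundaryIntegral (fun x => w x - q x) = 0

open Classical in
/-- The local projection `Π w ∈ ℙ₁(K)` of `w ∈ H¹(K) ∩ C(K̄)`. -/
def proj (w : Plane → ℝ) : Plane →ᵃ[ℝ] ℝ :=
  if h : ∃ q, K.IsProj w q then h.choose else 0

/-- `a_K(Πv, Πw) = (∇Πv, ∇Πw)_K`. -/
def projEnergy (v w : Plane → ℝ) : ℝ :=
  ∫ x in K.carrier, inner ℝ (gradient (K.proj v) x) (gradient (K.proj w) x)

/-- The slice `w - Πw`. -/
def slice (w : Plane → ℝ) : Plane → ℝ := fun x => w x - K.proj w x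

/-- The stabilization: the sum over the edges of the products of end point differences. -/
def stab (v w : Plane → ℝ) : ℝ :=
  ∑ i, (v (K.edgeEnd i) - v (K.edgeStart i)) * (w (K.edgeEnd i) - w (K.edgeStart i))

end PolygonalElement

/-- A finite decomposition of `Ω` into open polygons. -/
structure PolygonalMesh (Ω : Set Plane) where
  /-- the number of elements -/
  N : ℕ
  /-- the elements -/
  elem : Fin N → PolygonalElement
  subset : ∀ k, (elem k).carrier ⊆ Ω
  disjoint : ∀ k l, k ≠ l → Disjoint (elem k).carrier (elem l).carrier
  cover : closure Ω = ⋃ k, closure (elem k).carrier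

namespace PolygonalMesh

variable {Ω : Set Plane} (T : PolygonalMesh Ω)

/-- The global virtual element space `V_h = {v ∈ H¹₀(Ω) : v|_K ∈ V_K for all K}`. -/
def MemVh (v : Plane → ℝ) : Prop :=
  MemH10 Ω v ∧ ∀ k, (T.elem k).MemVK v

/-- `uI ∈ V_h` is the nodal interpolation of `u`: it agrees with `u` at all vertices. -/
def IsNodalInterpolation (u uI : Plane → ℝ) : Prop :=
  T.MemVh uI ∧ ∀ k, ∀ i : Fin (T.elem k).n, uI ((T.elem k).poly i) = u ((T.elem k).poly i)

/-- The discrete bilinear form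
`a_h(v, w) = ∑_K a_K(Πv, Πw) + ∑_K S_K(v - Πv, w - Πw)`. -/
def ah (v w : Plane → ℝ) : ℝ :=
  ∑ k, (T.elem k).projEnergy v w +
    ∑ k, (T.elem k).stab ((T.elem k).slice v) ((T.elem k).slice w)

/-- The mesh-dependent norm `|||v||| = a_h(v, v)^{1/2}`. -/
def tripleNorm (v : Plane → ℝ) : ℝ := √(T.ah v v)

/-- `uh ∈ V_h` solves the discretization `a_h(uh, vh) = (f, Π vh)` for all `vh ∈ V_h`. -/
def IsVEMSolution (f uh : Plane → ℝ) : Prop :=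
  T.MemVh uh ∧ ∀ vh : Plane → ℝ, T.MemVh vh →
    T.ah uh vh = ∑ k, ∫ x in (T.elem k).carrier, f x * (T.elem k).proj vh x

end PolygonalMesh

end VEM

end

/-! Write `e = uh - uI`, and on an element `K` let `g` be the normal derivative of `u - Πu`. The
discrete equation gives `a_h(e, e) = (f, Πe) - a_h(uI, e)`, so the task is to rewrite `(f, Πe)`.
Testing Green's formula for `u - Πu` with `e - Πe`, where `Δ(u - Πu) = -f`, gives on each `K` `(f,
Πe) = (∇Πu, ∇Πe) + ∫_{∂K} g (e - Πe) + [(f, e) - (∇u, ∇e)]`. The brackets sum to zero over the mesh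
by the weak formulation, whence the error identity `ah_sub_self_eq`: `a_h(e, e) = ∑_K ((∇Π(u - uI),
∇Πe) + ∫_{∂K} g (e - Πe) - S(uI - ΠuI, e - Πe))`.

The first and third terms are handled by Young's inequality. For the second, `e - Πe` is affine on
edges and has zero mean on `∂K`. Walking along the polyline bounds it by four times the sum of its
edge differences (`IsEdgewiseAffine.abs_edgePath_le`). Two Cauchy-Schwarz inequalities over the
edges then produce the factor `n²` (`sq_boundaryIntegral_mul_le`). No shape regularity enters, so
the constant is absolute. The weights in Young's inequality leave half of `a_h(e, e)` on the right,
to be absorbed. -/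

namespace VEM

/-! ### Weak gradients -/

section L2

variable {α : Type*} [MeasurableSpace α] {μ : Measure α}

lemma integrable_mul_of_memLp_two {f g : α → ℝ} (hf : MemLp f 2 μ) (hg : MemLp g 2 μ) :
    Integrable (fun x => f x * g x) μ :=
  hf.integrable_mul hg

lemma integrable_inner_of_memLp_two {F G : α → Plane} (hF : MemLp F 2 μ) (hG : MemLp G 2 μ) :
    Integrable (fun x => inner ℝ (F x) (G x)) μ := by
  refine Integrable.mono' (hF.norm.integrable_mul hG.norm) (hF.1.inner hG.1) (.of_forall fun x => ?_)
  exact norm_inner_le_norm _ _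

end L2

/-! ### Test functions. -/

namespace IsTestFunction

variable {U V : Set Plane} {φ ψ : Plane → ℝ}

lemma mono (h : IsTestFunction V φ) (hVU : V ⊆ U) : IsTestFunction U φ :=
  ⟨h.1, h.2.1, h.2.2.trans hVU⟩

lemma continuous (h : IsTestFunction U φ) : Continuous φ := h.1.continuous

lemma continuous_fderiv (h : IsTestFunction U φ) (a : Plane) :
    Continuous fun x => fderiv ℝ φ x a :=
  (h.1.continuous_fderiv (by simp)).clm_apply continuous_const

lemma hasCompactSupport_fderiv (h : IsTestFunction U φ) (a : Plane) :
    HasCompactSupport fun x => fderiv ℝ φ x a :=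
  (h.2.1.fderiv (𝕜 := ℝ)).comp_left (g := fun L : Plane →L[ℝ] ℝ => L a) (by simp)

lemma eq_zero (h : IsTestFunction U φ) {x : Plane} (hx : x ∉ U) : φ x = 0 :=
  image_eq_zero_of_notMem_tsupport fun hx' => hx (h.2.2 hx')

lemma fderiv_eq_zero (h : IsTestFunction U φ) {x : Plane} (hx : x ∉ U) : fderiv ℝ φ x = 0 :=
  image_eq_zero_of_notMem_tsupport fun hx' => hx (h.2.2 (tsupport_fderiv_subset ℝ hx'))

lemma memLp (h : IsTestFunction U φ) (μ : Measure Plane) [IsFiniteMeasureOnCompacts μ] :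
    MemLp φ 2 μ :=
  h.continuous.memLp_of_hasCompactSupport h.2.1

lemma memLp_fderiv (h : IsTestFunction U φ) (a : Plane) (μ : Measure Plane)
    [IsFiniteMeasureOnCompacts μ] : MemLp (fun x => fderiv ℝ φ x a) 2 μ :=
  (h.continuous_fderiv a).memLp_of_hasCompactSupport (h.hasCompactSupport_fderiv a)

lemma continuous_gradient (h : IsTestFunction U φ) : Continuous (gradient φ) :=
  (InnerProductSpace.toDual ℝ Plane).symm.continuous.comp (h.1.continuous_fderiv (by simp))

lemma memLp_gradient (h : IsTestFunction U φ) (μ : Measure Plane)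
    [IsFiniteMeasureOnCompacts μ] : MemLp (gradient φ) 2 μ :=
  h.continuous_gradient.memLp_of_hasCompactSupport
    ((h.2.1.fderiv (𝕜 := ℝ)).comp_left (g := (InnerProductSpace.toDual ℝ Plane).symm) (by simp))

lemma sub (h : IsTestFunction U φ) (h' : IsTestFunction U ψ) :
    IsTestFunction U (fun x => φ x - ψ x) :=
  ⟨h.1.sub h'.1, h.2.1.sub h'.2.1,
    (tsupport_sub φ ψ).trans (Set.union_subset h.2.2 h'.2.2)⟩

end IsTestFunction

lemma inner_gradient (φ : Plane → ℝ) (x a : Plane) : inner ℝ (gradient φ x) a = fderiv ℝ φ x a := by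
  simp [gradient]

namespace IsWeakGradient

variable {U V : Set Plane} {v w : Plane → ℝ} {G H : Plane → Plane}

lemma sub (hv : IsWeakGradient U v G) (hw : IsWeakGradient U w H) :
    IsWeakGradient U (fun x => v x - w x) (fun x => G x - H x) := by
  refine ⟨hv.1.sub hw.1, hv.2.1.sub hw.2.1, fun φ hφ a => ?_⟩
  have h1 := hφ.memLp_fderiv a (volume.restrict U)
  have h2 := hφ.memLp (volume.restrict U)
  simp only [sub_mul, inner_sub_left]
  rw [integral_sub (integrable_mul_of_memLp_two hv.1 h1) (integrable_mul_of_memLp_two hw.1 h1),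
    integral_sub (integrable_mul_of_memLp_two (hv.2.1.inner_const a) h2)
      (integrable_mul_of_memLp_two (hw.2.1.inner_const a) h2), hv.2.2 φ hφ a, hw.2.2 φ hφ a]
  ring

lemma mono (hU : IsOpen U) (hVU : V ⊆ U) (h : IsWeakGradient U v G) :
    IsWeakGradient V v G := by
  refine ⟨h.1.mono_measure (Measure.restrict_mono hVU le_rfl),
    h.2.1.mono_measure (Measure.restrict_mono hVU le_rfl), fun φ hφ a => ?_⟩
  rw [← setIntegral_eq_of_subset_of_forall_sdiff_eq_zero hU.measurableSet hVU
      (fun x hx => by simp [hφ.fderiv_eq_zero hx.2]),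
    ← setIntegral_eq_of_subset_of_forall_sdiff_eq_zero hU.measurableSet hVU
      (fun x hx => by simp [hφ.eq_zero hx.2])]
  exact h.2.2 φ (hφ.mono hVU) a

/-- Fundamental lemma of the calculus of variations. It serves twice: for uniqueness of weak
gradients, and to identify the Laplacian in Green's formula with `-f`. -/
lemma ae_eq_of_forall_integral_test (hU : IsOpen U) {d e : Plane → ℝ}
    (hd : MemLp d 2 (volume.restrict U)) (he : MemLp e 2 (volume.restrict U))
    (h : ∀ φ, IsTestFunction U φ → ∫ x in U, d x * φ x = ∫ x in U, e x * φ x) :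
    d =ᵐ[volume.restrict U] e := by
  have hde := hd.sub he
  have key : ∀ᵐ x, x ∈ U → (d - e) x = 0 := by
    refine hU.ae_eq_zero_of_integral_contDiff_smul_eq_zero
      (locallyIntegrableOn_of_locallyIntegrable_restrict
        (hde.locallyIntegrable (by norm_num))) fun φ h1 h2 h3 => ?_
    have hφ : IsTestFunction U φ := ⟨h1, h2, h3⟩
    rw [← setIntegral_eq_integral_of_forall_compl_eq_zero (s := U)
      (fun x hx => by simp [hφ.eq_zero hx])]
    have h4 := hφ.memLp (volume.restrict U)
    have : ∀ x, φ x • (d - e) x = d x * φ x - e x * φ x := fun x => by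
      simp only [Pi.sub_apply, smul_eq_mul]; ring
    simp only [this]
    rw [integral_sub (integrable_mul_of_memLp_two hd h4) (integrable_mul_of_memLp_two he h4), h φ hφ, sub_self]
  filter_upwards [(ae_restrict_iff' hU.measurableSet).2 key] with x hx
  simpa [sub_eq_zero] using hx

/-- Makes the arbitrary choice in `weakGrad` harmless: identities for it hold almost everywhere. -/
lemma ae_eq (hU : IsOpen U) (hG : IsWeakGradient U v G) (hH : IsWeakGradient U v H) :
    G =ᵐ[volume.restrict U] H := by
  have key : ∀ i : Fin 2, ∀ᵐ x ∂volume.restrict U, G x i = H x i := fun i => by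
    have := ae_eq_of_forall_integral_test hU
      (hG.2.1.inner_const (𝕜 := ℝ) (EuclideanSpace.single i (1 : ℝ)))
      (hH.2.1.inner_const (𝕜 := ℝ) (EuclideanSpace.single i (1 : ℝ))) fun φ hφ => by
        have h1 := hG.2.2 φ hφ (EuclideanSpace.single i (1 : ℝ))
        have h2 := hH.2.2 φ hφ (EuclideanSpace.single i (1 : ℝ))
        linarith
    filter_upwards [this] with x hx
    simpa [EuclideanSpace.inner_single_right] using hx
  filter_upwards [key 0, key 1] with x h0 h1
  ext i
  fin_cases i
  · exact h0
  · exact h1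

lemma memH1 (h : IsWeakGradient U v G) : MemH1 U v := ⟨G, h⟩

/-- Since `φ` vanishes off `U`, the integration by parts takes place on the whole plane, and no
regularity of `∂U` is needed. -/
lemma of_contDiff (hv : ContDiff ℝ ∞ v) (h1 : MemLp v 2 (volume.restrict U))
    (h2 : MemLp (gradient v) 2 (volume.restrict U)) : IsWeakGradient U v (gradient v) := by
  refine ⟨h1, h2, fun φ hφ a => ?_⟩
  rw [setIntegral_eq_integral_of_forall_compl_eq_zero
      (fun x hx => by simp [hφ.fderiv_eq_zero hx]),
    setIntegral_eq_integral_of_forall_compl_eq_zero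
      (fun x hx => by simp [hφ.eq_zero hx])]
  simp only [inner_gradient]
  have hc : Continuous fun x => fderiv ℝ v x a :=
    (hv.continuous_fderiv (by simp)).clm_apply continuous_const
  exact integral_mul_fderiv_eq_neg_fderiv_mul_of_integrable
    ((hc.mul hφ.continuous).integrable_of_hasCompactSupport hφ.2.1.mul_left)
    ((hv.continuous.mul (hφ.continuous_fderiv a)).integrable_of_hasCompactSupport
      (hφ.hasCompactSupport_fderiv a).mul_left)
    ((hv.continuous.mul hφ.continuous).integrable_of_hasCompactSupport hφ.2.1.mul_left)
    (fun x _ => hv.differentiable (by simp) x)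
    (fun x _ => hφ.1.differentiable (by simp) x)

end IsWeakGradient

section WeakGrad

variable {U V : Set Plane} {v w : Plane → ℝ} {G : Plane → Plane}

lemma MemH1.isWeakGradient (h : MemH1 U v) : IsWeakGradient U v (weakGrad U v) := by
  rw [weakGrad, dif_pos h]
  exact h.choose_spec

lemma MemH1.memLp (h : MemH1 U v) : MemLp v 2 (volume.restrict U) := h.isWeakGradient.1

lemma MemH1.memLp_weakGrad (h : MemH1 U v) : MemLp (weakGrad U v) 2 (volume.restrict U) :=
  h.isWeakGradient.2.1

lemma IsWeakGradient.weakGrad_ae_eq (hU : IsOpen U) (h : IsWeakGradient U v G) :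
    weakGrad U v =ᵐ[volume.restrict U] G :=
  h.memH1.isWeakGradient.ae_eq hU h

lemma MemH1.sub (hv : MemH1 U v) (hw : MemH1 U w) : MemH1 U (fun x => v x - w x) :=
  (hv.isWeakGradient.sub hw.isWeakGradient).memH1

lemma weakGrad_sub (hU : IsOpen U) (hv : MemH1 U v) (hw : MemH1 U w) :
    weakGrad U (fun x => v x - w x) =ᵐ[volume.restrict U]
      fun x => weakGrad U v x - weakGrad U w x :=
  (hv.isWeakGradient.sub hw.isWeakGradient).weakGrad_ae_eq hU

lemma MemH1.mono (hU : IsOpen U) (hVU : V ⊆ U) (h : MemH1 U v) : MemH1 V v :=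
  (h.isWeakGradient.mono hU hVU).memH1

lemma weakGrad_mono (hU : IsOpen U) (hV : IsOpen V) (hVU : V ⊆ U) (h : MemH1 U v) :
    weakGrad V v =ᵐ[volume.restrict V] weakGrad U v :=
  (h.isWeakGradient.mono hU hVU).weakGrad_ae_eq hV

lemma IsTestFunction.isWeakGradient (h : IsTestFunction V v) :
    IsWeakGradient U v (gradient v) :=
  .of_contDiff h.1 (h.memLp _) (h.memLp_gradient _)

lemma IsTestFunction.memH10 (hU : IsOpen U) (h : IsTestFunction U v) : MemH10 U v := by
  have hw := h.isWeakGradient (U := U)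
  refine ⟨hw.memH1, fun _ => v, fun _ => h, by simp, ?_⟩
  have : eLpNorm (fun x => weakGrad U v x - gradient v x) 2 (volume.restrict U) = 0 := by
    rw [eLpNorm_congr_ae (g := 0), eLpNorm_zero]
    filter_upwards [hw.weakGrad_ae_eq hU] with x hx
    simp [hx]
  simp [this]

lemma tendsto_eLpNorm_sub_sub {E : Type*} [NormedAddCommGroup E] {μ : Measure Plane}
    {v w : Plane → E} {φ ψ : ℕ → Plane → E}
    (hφ : ∀ m, AEStronglyMeasurable (fun x => v x - φ m x) μ)
    (hψ : ∀ m, AEStronglyMeasurable (fun x => w x - ψ m x) μ)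
    (h1 : Filter.Tendsto (fun m => eLpNorm (fun x => v x - φ m x) 2 μ) Filter.atTop (nhds 0))
    (h2 : Filter.Tendsto (fun m => eLpNorm (fun x => w x - ψ m x) 2 μ) Filter.atTop (nhds 0)) :
    Filter.Tendsto (fun m => eLpNorm (fun x => (v x - w x) - (φ m x - ψ m x)) 2 μ)
      Filter.atTop (nhds 0) := by
  refine tendsto_of_tendsto_of_tendsto_of_le_of_le tendsto_const_nhds
    (by simpa using h1.add h2) (fun _ => zero_le) fun m => ?_
  have : (fun x => (v x - w x) - (φ m x - ψ m x)) =
      (fun x => v x - φ m x) - fun x => w x - ψ m x := by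
    ext x; simp only [Pi.sub_apply]; abel
  rw [this]
  exact eLpNorm_sub_le (hφ m) (hψ m) (by norm_num)

/-- Needed for `uh - uI` to be admissible in both the continuous and the discrete problem. -/
lemma MemH10.sub (hU : IsOpen U) (hv : MemH10 U v) (hw : MemH10 U w) :
    MemH10 U (fun x => v x - w x) := by
  obtain ⟨hv1, φ, hφ, h1, h2⟩ := hv
  obtain ⟨hw1, ψ, hψ, h3, h4⟩ := hw
  refine ⟨hv1.sub hw1, fun m x => φ m x - ψ m x, fun m => (hφ m).sub (hψ m), ?_, ?_⟩
  · exact tendsto_eLpNorm_sub_sub (fun m => (hv1.memLp.sub ((hφ m).memLp _)).1)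
      (fun m => (hw1.memLp.sub ((hψ m).memLp _)).1) h1 h3
  · refine (tendsto_eLpNorm_sub_sub
      (fun m => (hv1.memLp_weakGrad.sub ((hφ m).memLp_gradient _)).1)
      (fun m => (hw1.memLp_weakGrad.sub ((hψ m).memLp_gradient _)).1) h2 h4).congr fun m => ?_
    refine eLpNorm_congr_ae ?_
    filter_upwards [weakGrad_sub hU hv1 hw1] with x hx
    have : gradient (fun x => φ m x - ψ m x) x = gradient (φ m) x - gradient (ψ m) x := by
      simp only [gradient]
      rw [fderiv_fun_sub ((hφ m).1.differentiable (by simp) x)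
        ((hψ m).1.differentiable (by simp) x), map_sub]
    rw [hx, this]

end WeakGrad

/-! ### Affine functions -/

section Affine

variable (q p : Plane →ᵃ[ℝ] ℝ)

lemma affine_coe_eq :
    (q : Plane → ℝ) = fun x => LinearMap.toContinuousLinearMap q.linear x + q 0 := by
  ext x
  simpa using congrFun q.decomp x

lemma contDiff_affine : ContDiff ℝ ∞ q := by
  rw [affine_coe_eq q]
  exact (ContinuousLinearMap.contDiff _).add contDiff_const

lemma continuous_affine : Continuous q := (contDiff_affine q).continuous

lemma fderiv_affine (x : Plane) : fderiv ℝ q x = LinearMap.toContinuousLinearMap q.linear := by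
  conv_lhs => rw [affine_coe_eq q]
  rw [fderiv_add_const, ContinuousLinearMap.fderiv]

lemma gradient_affine (x : Plane) : gradient q x = gradient q 0 := by
  simp only [gradient, fderiv_affine]

lemma affine_apply (x : Plane) : q x = inner ℝ (gradient q 0) x + q 0 := by
  rw [inner_gradient, fderiv_affine]
  exact congrFun (affine_coe_eq q) x

lemma exists_affine (a : Plane) (c : ℝ) :
    ∃ q : Plane →ᵃ[ℝ] ℝ, gradient q 0 = a ∧ ∀ x, q x = inner ℝ a x + c := by
  let q : Plane →ᵃ[ℝ] ℝ := (innerSL ℝ a).toLinearMap.toAffineMap + AffineMap.const ℝ Plane c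
  have hq : ∀ x, q x = inner ℝ a x + c := fun x => by simp [q]
  refine ⟨q, ext_inner_right ℝ fun y => ?_, hq⟩
  have h1 := affine_apply q y
  have h2 := hq 0
  rw [hq, h2] at h1
  simpa using h1.symm

lemma gradient_affine_sub : gradient (q - p : Plane →ᵃ[ℝ] ℝ) 0 = gradient q 0 - gradient p 0 := by
  simp only [gradient, fderiv_affine, ← map_sub, AffineMap.sub_linear]

end Affine

namespace PolygonalElement

variable (K : PolygonalElement)

/-! ### Geometry of polygonal elements -/

lemma isFiniteMeasure : IsFiniteMeasure (volume.restrict K.carrier) :=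
  ⟨by simpa using K.isBounded.measure_lt_top⟩

lemma volume_real_pos : 0 < volume.real K.carrier :=
  ENNReal.toReal_pos (K.isOpen.measure_pos _ K.isConnected.nonempty).ne'
    K.isBounded.measure_lt_top.ne

lemma edgePath_apply (i : Fin K.n) (t : ℝ) :
    K.poly.edgePath ℝ i t = AffineMap.lineMap (K.edgeStart i) (K.edgeEnd i) t := rfl

lemma continuous_edgePath (i : Fin K.n) : Continuous fun t : ℝ => K.poly.edgePath ℝ i t :=
  AffineMap.lineMap_continuous

lemma edgePath_mem_frontier (i : Fin K.n) {t : ℝ} (ht : t ∈ Set.Icc (0 : ℝ) 1) :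
    K.poly.edgePath ℝ i t ∈ frontier K.carrier := by
  rw [K.frontier_eq]
  exact Set.mem_iUnion.2 ⟨i, t, ht, rfl⟩

lemma edgePath_mem_closure (i : Fin K.n) {t : ℝ} (ht : t ∈ Set.Icc (0 : ℝ) 1) :
    K.poly.edgePath ℝ i t ∈ closure K.carrier :=
  frontier_subset_closure (K.edgePath_mem_frontier i ht)

lemma edgePath_notMem (i : Fin K.n) {t : ℝ} (ht : t ∈ Set.Icc (0 : ℝ) 1) :
    K.poly.edgePath ℝ i t ∉ K.carrier := by
  have := K.edgePath_mem_frontier i ht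
  rw [K.isOpen.frontier_eq] at this
  exact this.2

/-- Without edges the frontier is empty, so the nonempty carrier is clopen, hence the whole plane,
which is unbounded. -/
lemma n_pos : 0 < K.n := by
  by_contra h
  have hn : K.n = 0 := by omega
  have : IsEmpty (Fin K.n) := by rw [hn]; infer_instance
  have hf : frontier K.carrier = ∅ := by
    rw [K.frontier_eq, Polygon.boundary, Set.iUnion_of_empty]
  have huniv := (isClopen_iff_frontier_eq_empty.2 hf).eq_univ K.isConnected.nonempty
  exact NormedSpace.unbounded_univ ℝ Plane (huniv ▸ K.isBounded)

/-- A degenerate edge would take the same value at the parameters `0` and `1/2`, contradicting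
`simple`. -/
lemma edgeLength_pos (i : Fin K.n) : 0 < K.edgeLength i := by
  refine dist_pos.2 fun h => ?_
  have := (K.simple i i 0 (by norm_num) (1 / 2) (by norm_num) (by
    simp [edgePath_apply, ← h])).2
  norm_num at this

lemma sum_edgeLength_pos : 0 < ∑ i, K.edgeLength i :=
  Finset.sum_pos (fun i _ => K.edgeLength_pos i) ⟨⟨0, K.n_pos⟩, Finset.mem_univ _⟩

lemma volume_frontier : volume (frontier K.carrier) = 0 := by
  rw [K.frontier_eq, Polygon.boundary, measure_iUnion_null_iff]
  intro i
  have hsub : K.poly.edgeSet ℝ i ⊆ line[ℝ, K.edgeStart i, K.edgeEnd i] := by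
    rintro _ ⟨t, -, rfl⟩
    exact AffineMap.lineMap_mem_affineSpan_pair _ _ _
  refine measure_mono_null hsub (Measure.addHaar_affineSubspace _ _ fun htop => ?_)
  have h1 : Module.finrank ℝ (line[ℝ, K.edgeStart i, K.edgeEnd i]).direction = 2 := by
    rw [htop, AffineSubspace.direction_top, finrank_top]; simp
  have h2 := collinear_iff_finrank_le_one.1 (collinear_pair ℝ (K.edgeStart i) (K.edgeEnd i))
  rw [direction_affineSpan] at h1
  omega

/-! ### Boundary integrals -/

variable {K}

lemma continuousOn_edge {w : Plane → ℝ} (hw : ContinuousOn w (closure K.carrier)) (i : Fin K.n) :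
    ContinuousOn (fun t : ℝ => w (K.poly.edgePath ℝ i t)) (Set.Icc 0 1) :=
  hw.comp (K.continuous_edgePath i).continuousOn fun _ ht => K.edgePath_mem_closure i ht

lemma intervalIntegrable_edge {w : Plane → ℝ} (hw : ContinuousOn w (closure K.carrier))
    (i : Fin K.n) : IntervalIntegrable (fun t : ℝ => w (K.poly.edgePath ℝ i t)) volume 0 1 :=
  ContinuousOn.intervalIntegrable_of_Icc zero_le_one (continuousOn_edge hw i)

lemma boundaryIntegral_sub {v w : Plane → ℝ} (hv : ContinuousOn v (closure K.carrier))
    (hw : ContinuousOn w (closure K.carrier)) :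
    K.boundaryIntegral (fun x => v x - w x) = K.boundaryIntegral v - K.boundaryIntegral w := by
  simp only [boundaryIntegral, edgeIntegral, ← Finset.sum_sub_distrib, ← mul_sub]
  refine Finset.sum_congr rfl fun i _ => ?_
  rw [intervalIntegral.integral_sub (intervalIntegrable_edge hv i) (intervalIntegrable_edge hw i)]

lemma boundaryIntegral_const (c : ℝ) :
    K.boundaryIntegral (fun _ => c) = (∑ i, K.edgeLength i) * c := by
  simp [boundaryIntegral, edgeIntegral, Finset.sum_mul]

/-! ### The local projection -/

/-- The gradients of affine `p` are exactly the constant vectors, so the orthogonality says that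
`∇q` is the mean of `∇w` over `K`. In this linear form, existence, uniqueness and additivity of `Π`
can be read off. -/
lemma isProj_iff {w : Plane → ℝ} (hw : MemH1 K.carrier w)
    (hc : ContinuousOn w (closure K.carrier)) (q : Plane →ᵃ[ℝ] ℝ) :
    K.IsProj w q ↔
      volume.real K.carrier • gradient q 0 = ∫ x in K.carrier, weakGrad K.carrier w x ∧
        K.boundaryIntegral w = K.boundaryIntegral q := by
  have := K.isFiniteMeasure
  have hint : Integrable (weakGrad K.carrier w) (volume.restrict K.carrier) :=
    hw.memLp_weakGrad.integrable (by norm_num)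
  have key : ∀ b : Plane, ∫ x in K.carrier, inner ℝ (weakGrad K.carrier w x - gradient q 0) b =
      inner ℝ ((∫ x in K.carrier, weakGrad K.carrier w x) -
        volume.real K.carrier • gradient q 0) b := fun b => by
    simp only [real_inner_comm b]
    have h := integral_inner (𝕜 := ℝ) (hint.sub (integrable_const (gradient q 0))) b
    simp only [Pi.sub_apply] at h
    rw [h, integral_sub hint (integrable_const _), setIntegral_const]
  rw [IsProj, boundaryIntegral_sub hc (continuous_affine q).continuousOn, sub_eq_zero]
  refine and_congr_left fun _ => ?_
  simp only [gradient_affine _ _]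
  constructor
  · intro h
    refine (sub_eq_zero.1 (ext_inner_right ℝ fun b => ?_)).symm
    obtain ⟨p, hp, -⟩ := exists_affine b 0
    rw [← key, inner_zero_left, ← hp]
    simpa only [gradient_affine _ _] using h p
  · intro h p
    rw [key, h, sub_self, inner_zero_left]

lemma IsProj.unique {w : Plane → ℝ} (hw : MemH1 K.carrier w)
    (hc : ContinuousOn w (closure K.carrier)) {q p : Plane →ᵃ[ℝ] ℝ}
    (hq : K.IsProj w q) (hp : K.IsProj w p) : q = p := by
  rw [isProj_iff hw hc] at hq hp
  have hg : gradient q 0 = gradient p 0 :=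
    smul_right_injective _ K.volume_real_pos.ne' (hq.1.trans hp.1.symm)
  have hsub : ∀ x, q x - p x = q 0 - p 0 := fun x => by
    rw [affine_apply q, affine_apply p, hg]; ring
  -- Equal gradients leave only a constant difference, which the boundary means force to vanish
  -- because the perimeter is positive.
  have hb := boundaryIntegral_sub (K := K) (continuous_affine q).continuousOn
    (continuous_affine p).continuousOn
  simp only [hsub] at hb
  rw [boundaryIntegral_const, ← hq.2, ← hp.2, sub_self, mul_eq_zero] at hb
  have h0 := hb.resolve_left K.sum_edgeLength_pos.ne'
  ext x
  have := hsub x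
  linarith

lemma isProj_proj {w : Plane → ℝ} (hw : MemH1 K.carrier w)
    (hc : ContinuousOn w (closure K.carrier)) : K.IsProj w (K.proj w) := by
  have h : ∃ q, K.IsProj w q := by
    -- The gradient is the mean of `∇w`; the additive constant then corrects the boundary mean.
    let a : Plane := (volume.real K.carrier)⁻¹ • ∫ x in K.carrier, weakGrad K.carrier w x
    have ha : ContinuousOn (fun x : Plane => inner ℝ a x) (closure K.carrier) := by fun_prop
    obtain ⟨q, hq, hq'⟩ := exists_affine a ((∑ i, K.edgeLength i)⁻¹ *
      (K.boundaryIntegral w - K.boundaryIntegral fun x => inner ℝ a x))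
    refine ⟨q, (isProj_iff hw hc q).2 ⟨?_, ?_⟩⟩
    · rw [hq, smul_inv_smul₀ K.volume_real_pos.ne']
    · have h1 := boundaryIntegral_sub (K := K) (continuous_affine q).continuousOn ha
      simp only [hq', add_sub_cancel_left] at h1
      rw [boundaryIntegral_const, mul_inv_cancel_left₀ K.sum_edgeLength_pos.ne'] at h1
      linarith
  rw [proj, dif_pos h]
  exact h.choose_spec

lemma proj_sub {v w : Plane → ℝ} (hv : MemH1 K.carrier v) (hw : MemH1 K.carrier w)
    (hvc : ContinuousOn v (closure K.carrier)) (hwc : ContinuousOn w (closure K.carrier)) :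
    K.proj (fun x => v x - w x) = K.proj v - K.proj w := by
  have := K.isFiniteMeasure
  have hsc : ContinuousOn (fun x => v x - w x) (closure K.carrier) := hvc.sub hwc
  refine (isProj_proj (hv.sub hw) hsc).unique (hv.sub hw) hsc ?_
  have h1 := (isProj_iff hv hvc _).1 (isProj_proj hv hvc)
  have h2 := (isProj_iff hw hwc _).1 (isProj_proj hw hwc)
  refine (isProj_iff (hv.sub hw) hsc _).2 ⟨?_, ?_⟩
  · rw [gradient_affine_sub, smul_sub, h1.1, h2.1, integral_congr_ae (weakGrad_sub K.isOpen hv hw),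
      integral_sub (hv.memLp_weakGrad.integrable (by norm_num))
        (hw.memLp_weakGrad.integrable (by norm_num))]
  · rw [boundaryIntegral_sub hvc hwc, h1.2, h2.2, ← boundaryIntegral_sub
      (continuous_affine _).continuousOn (continuous_affine _).continuousOn]
    rfl

lemma slice_sub {v w : Plane → ℝ} (hv : MemH1 K.carrier v) (hw : MemH1 K.carrier w)
    (hvc : ContinuousOn v (closure K.carrier)) (hwc : ContinuousOn w (closure K.carrier)) (x : Plane) :
    K.slice (fun x => v x - w x) x = K.slice v x - K.slice w x := by
  simp only [slice, proj_sub hv hw hvc hwc, AffineMap.coe_sub, Pi.sub_apply]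
  ring

lemma memLp_affine (q : Plane →ᵃ[ℝ] ℝ) : MemLp q 2 (volume.restrict K.carrier) := by
  have := K.isFiniteMeasure
  obtain ⟨C, hC⟩ := K.isBounded.isCompact_closure.exists_bound_of_continuousOn
    (continuous_affine q).continuousOn
  refine .of_bound (continuous_affine q).aestronglyMeasurable C ?_
  filter_upwards [ae_restrict_mem K.isOpen.measurableSet] with x hx using hC x (subset_closure hx)

lemma isWeakGradient_affine (q : Plane →ᵃ[ℝ] ℝ) :
    IsWeakGradient K.carrier q (fun _ => gradient q 0) := by
  have := K.isFiniteMeasure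
  have hq : gradient q = fun _ => gradient q 0 := funext (gradient_affine q)
  rw [← hq]
  exact .of_contDiff (contDiff_affine q) (memLp_affine q) (hq ▸ memLp_const _)

lemma isWeakGradient_slice {w : Plane → ℝ} (hw : MemH1 K.carrier w) :
    IsWeakGradient K.carrier (K.slice w)
      (fun x => weakGrad K.carrier w x - gradient (K.proj w) 0) :=
  hw.isWeakGradient.sub (isWeakGradient_affine _)

lemma continuousOn_slice {w : Plane → ℝ} {s : Set Plane} (hw : ContinuousOn w s) :
    ContinuousOn (K.slice w) s :=
  hw.sub (continuous_affine _).continuousOn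

lemma projEnergy_eq (v w : Plane → ℝ) : K.projEnergy v w =
    volume.real K.carrier * inner ℝ (gradient (K.proj v) 0) (gradient (K.proj w) 0) := by
  simp only [projEnergy, gradient_affine _ _, setIntegral_const, smul_eq_mul]

lemma integral_weakGrad {w : Plane → ℝ} (hw : MemH1 K.carrier w)
    (hc : ContinuousOn w (closure K.carrier)) :
    ∫ x in K.carrier, weakGrad K.carrier w x =
      volume.real K.carrier • gradient (K.proj w) 0 :=
  ((isProj_iff hw hc _).1 (isProj_proj hw hc)).1.symm

lemma boundaryIntegral_slice {w : Plane → ℝ} (hw : MemH1 K.carrier w)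
    (hc : ContinuousOn w (closure K.carrier)) : K.boundaryIntegral (K.slice w) = 0 :=
  (isProj_proj hw hc).2

end PolygonalElement

namespace PolygonalElement

variable {K : PolygonalElement}

/-! ### Functions that are affine on the edges -/

variable (K) in
/-- `w` is affine on every edge of `K`. -/
def IsEdgewiseAffine (w : Plane → ℝ) : Prop :=
  ∀ i : Fin K.n, ∀ t ∈ Set.Icc (0 : ℝ) 1,
    w (K.poly.edgePath ℝ i t) = (1 - t) * w (K.edgeStart i) + t * w (K.edgeEnd i)

lemma isEdgewiseAffine_affine (q : Plane →ᵃ[ℝ] ℝ) : K.IsEdgewiseAffine q := fun i t _ => by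
  rw [edgePath_apply, AffineMap.apply_lineMap, AffineMap.lineMap_apply_ring]

lemma IsEdgewiseAffine.slice {w : Plane → ℝ} (hw : K.IsEdgewiseAffine w) :
    K.IsEdgewiseAffine (K.slice w) := fun i t ht => by
  simp only [PolygonalElement.slice, hw i t ht, isEdgewiseAffine_affine (K.proj w) i t ht]
  ring

variable (K) in
/-- The sum over the edges of the absolute differences of the end point values. -/
def edgeVariation (w : Plane → ℝ) : ℝ := ∑ i, |w (K.edgeEnd i) - w (K.edgeStart i)|

lemma edgeVariation_sq_le (w : Plane → ℝ) : K.edgeVariation w ^ 2 ≤ K.n * K.stab w w := by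
  have := sq_sum_le_card_mul_sum_sq (s := Finset.univ)
    (f := fun i => |w (K.edgeEnd i) - w (K.edgeStart i)|)
  simpa [edgeVariation, stab, sq_abs, ← pow_two] using this

lemma finRotate_mk {n m : ℕ} (h : m + 1 < n) :
    finRotate n ⟨m, by omega⟩ = ⟨m + 1, h⟩ := by
  cases n with
  | zero => omega
  | succ n => exact finRotate_of_lt (by omega)

/-- Telescoping along the polyline from vertex `0`; the closing edge is never crossed, so the
wrap-around of `finRotate` plays no role. -/
lemma abs_sub_le_sum_edges (w : Plane → ℝ) (m : ℕ) (hm : m < K.n) :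
    |w (K.edgeStart ⟨m, hm⟩) - w (K.edgeStart ⟨0, K.n_pos⟩)| ≤
      ∑ i : Fin K.n with i.val < m, |w (K.edgeEnd i) - w (K.edgeStart i)| := by
  induction m with
  | zero => simp
  | succ m ih =>
    have hm' : m < K.n := by omega
    have h1 : K.edgeStart ⟨m + 1, hm⟩ = K.edgeEnd ⟨m, hm'⟩ := by
      rw [edgeStart, edgeEnd, finRotate_mk hm]
    have h2 : (Finset.univ.filter fun i : Fin K.n => i.val < m + 1) =
        insert ⟨m, hm'⟩ (Finset.univ.filter fun i : Fin K.n => i.val < m) := by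
      ext i
      simp only [Finset.mem_filter, Finset.mem_univ, true_and, Finset.mem_insert, Fin.ext_iff]
      omega
    rw [h1, h2, Finset.sum_insert (by simp)]
    exact (abs_sub_le _ (w (K.edgeStart ⟨m, hm'⟩)) _).trans (add_le_add_right (ih hm') _)

lemma abs_edge_sub_le (w : Plane → ℝ) (i : Fin K.n) :
    |w (K.edgeEnd i) - w (K.edgeStart i)| ≤ K.edgeVariation w :=
  Finset.single_le_sum (f := fun i => |w (K.edgeEnd i) - w (K.edgeStart i)|)
    (fun _ _ => abs_nonneg _) (Finset.mem_univ i)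

lemma abs_edgeStart_sub_le (w : Plane → ℝ) (i : Fin K.n) :
    |w (K.edgeStart i) - w (K.edgeStart ⟨0, K.n_pos⟩)| ≤ K.edgeVariation w :=
  (abs_sub_le_sum_edges w i.1 i.2).trans
    (Finset.sum_le_sum_of_subset_of_nonneg (Finset.filter_subset _ _) fun _ _ _ => abs_nonneg _)

/-- One variation to reach the starting vertex of the edge, one more to move along it. -/
lemma IsEdgewiseAffine.abs_edgePath_sub_le {w : Plane → ℝ} (hw : K.IsEdgewiseAffine w)
    (i : Fin K.n) {t : ℝ} (ht : t ∈ Set.Icc (0 : ℝ) 1) :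
    |w (K.poly.edgePath ℝ i t) - w (K.edgeStart ⟨0, K.n_pos⟩)| ≤ 2 * K.edgeVariation w := by
  have h1 := abs_edge_sub_le w i
  have h2 := abs_edgeStart_sub_le w i
  have h3 : w (K.poly.edgePath ℝ i t) - w (K.edgeStart ⟨0, K.n_pos⟩) =
      t * (w (K.edgeEnd i) - w (K.edgeStart i)) +
        (w (K.edgeStart i) - w (K.edgeStart ⟨0, K.n_pos⟩)) := by
    rw [hw i t ht]; ring
  have h4 : |t * (w (K.edgeEnd i) - w (K.edgeStart i))| ≤ K.edgeVariation w := by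
    rw [abs_mul, abs_of_nonneg ht.1]
    exact (mul_le_of_le_one_left (abs_nonneg _) ht.2).trans h1
  rw [h3]
  linarith [abs_add_le (t * (w (K.edgeEnd i) - w (K.edgeStart i)))
    (w (K.edgeStart i) - w (K.edgeStart ⟨0, K.n_pos⟩))]

lemma IsEdgewiseAffine.abs_edgePath_le {w : Plane → ℝ} (hw : K.IsEdgewiseAffine w)
    (hc : ContinuousOn w (closure K.carrier)) (h0 : K.boundaryIntegral w = 0)
    (i : Fin K.n) {t : ℝ} (ht : t ∈ Set.Icc (0 : ℝ) 1) :
    |w (K.poly.edgePath ℝ i t)| ≤ 4 * K.edgeVariation w := by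
  set c := w (K.edgeStart ⟨0, K.n_pos⟩) with hcdef
  set D := K.edgeVariation w
  have h1 : |K.boundaryIntegral fun x => w x - c| ≤ (∑ i, K.edgeLength i) * (2 * D) := by
    rw [Finset.sum_mul]
    refine (Finset.abs_sum_le_sum_abs _ _).trans (Finset.sum_le_sum fun j _ => ?_)
    rw [edgeIntegral, abs_mul, abs_of_pos (K.edgeLength_pos j)]
    refine mul_le_mul_of_nonneg_left ?_ (K.edgeLength_pos j).le
    have := intervalIntegral.norm_integral_le_of_norm_le_const (a := 0) (b := 1) (C := 2 * D)
      (f := fun t : ℝ => w (K.poly.edgePath ℝ j t) - c) fun s hs => by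
        rw [Set.uIoc_of_le zero_le_one] at hs
        exact hw.abs_edgePath_sub_le j ⟨hs.1.le, hs.2⟩
    simpa using this
  rw [boundaryIntegral_sub hc continuousOn_const, h0, boundaryIntegral_const, zero_sub, abs_neg,
    abs_mul, abs_of_pos K.sum_edgeLength_pos] at h1
  -- As `w` has zero mean on `∂K`, the integral of `w - c` is `-c` times the perimeter.
  have h2 : |c| ≤ 2 * D := le_of_mul_le_mul_left h1 K.sum_edgeLength_pos
  have h3 := hw.abs_edgePath_sub_le i ht
  have h4 := abs_add_le (w (K.poly.edgePath ℝ i t) - c) c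
  rw [sub_add_cancel] at h4
  linarith

lemma sq_integral_abs_le {f : ℝ → ℝ} (hf : MemLp f 2 (volume.restrict (Set.Icc (0 : ℝ) 1))) :
    (∫ t in (0 : ℝ)..1, |f t|) ^ 2 ≤ ∫ t in (0 : ℝ)..1, f t ^ 2 := by
  have hf' : MemLp f 2 (volume.restrict (Set.Ioc (0 : ℝ) 1)) :=
    hf.mono_measure (Measure.restrict_mono Set.Ioc_subset_Icc_self le_rfl)
  have h1 : IntervalIntegrable (fun t => |f t|) volume 0 1 :=
    (intervalIntegrable_iff_integrableOn_Ioc_of_le zero_le_one).2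
      (hf'.integrable (by norm_num)).abs
  have h2 : IntervalIntegrable (fun t => f t ^ 2) volume 0 1 :=
    (intervalIntegrable_iff_integrableOn_Ioc_of_le zero_le_one).2 hf'.integrable_sq
  set m := ∫ t in (0 : ℝ)..1, |f t|
  -- The variance of `|f|` on the unit interval is nonnegative.
  have h3 : 0 ≤ ∫ t in (0 : ℝ)..1, (f t ^ 2 - 2 * m * |f t| + m ^ 2) := by
    refine intervalIntegral.integral_nonneg zero_le_one fun t _ => ?_
    rw [← sq_abs (f t)]
    nlinarith [sq_nonneg (|f t| - m)]
  rw [intervalIntegral.integral_add (h2.sub (h1.const_mul _)) (by simp),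
    intervalIntegral.integral_sub h2 (h1.const_mul _), intervalIntegral.integral_const_mul] at h3
  simp only [intervalIntegral.integral_const, sub_zero, one_smul] at h3
  change 0 ≤ _ - 2 * m * m + _ at h3
  nlinarith

/-- An `L^∞`-`L^1` bound on `∂K`. One factor `n` comes from bounding the variation by `stab`, the
other from summing the `L^1` norms of `g` over the edges; 16 is the square of the 4 in
`abs_edgePath_le`. -/
lemma sq_boundaryIntegral_mul_le {g w : Plane → ℝ} (hg : K.MemL2Boundary g)
    (hw : K.IsEdgewiseAffine w) (hc : ContinuousOn w (closure K.carrier))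
    (h0 : K.boundaryIntegral w = 0) :
    (K.boundaryIntegral fun x => g x * w x) ^ 2 ≤
      16 * K.stab w w *
        ((K.n : ℝ) ^ 2 * ∑ i, K.edgeLength i * K.edgeIntegral i fun x => g x ^ 2) := by
  set D := K.edgeVariation w
  set m : Fin K.n → ℝ := fun i => ∫ t in (0 : ℝ)..1, |g (K.poly.edgePath ℝ i t)|
  have h1 : |K.boundaryIntegral fun x => g x * w x| ≤ 4 * D * ∑ i, K.edgeLength i * m i := by
    rw [Finset.mul_sum]
    refine (Finset.abs_sum_le_sum_abs _ _).trans (Finset.sum_le_sum fun i _ => ?_)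
    rw [edgeIntegral, abs_mul, abs_of_pos (K.edgeLength_pos i), mul_left_comm]
    refine mul_le_mul_of_nonneg_left ?_ (K.edgeLength_pos i).le
    rw [← intervalIntegral.integral_const_mul]
    refine intervalIntegral.norm_integral_le_of_norm_le (f := fun t : ℝ =>
      g (K.poly.edgePath ℝ i t) * w (K.poly.edgePath ℝ i t)) zero_le_one
      (.of_forall fun t ht => ?_) ?_
    · rw [Real.norm_eq_abs, abs_mul, mul_comm]
      exact mul_le_mul_of_nonneg_right (hw.abs_edgePath_le hc h0 i ⟨ht.1.le, ht.2⟩)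
        (abs_nonneg _)
    · refine IntervalIntegrable.const_mul ?_ _
      exact (intervalIntegrable_iff_integrableOn_Ioc_of_le zero_le_one).2
        (((hg i).mono_measure (Measure.restrict_mono Set.Ioc_subset_Icc_self le_rfl)).integrable
          (by norm_num)).abs
  have h2 : (∑ i, K.edgeLength i * m i) ^ 2 ≤
      K.n * ∑ i, K.edgeLength i * K.edgeIntegral i fun x => g x ^ 2 := by
    have h3 := sq_sum_le_card_mul_sum_sq (s := Finset.univ) (f := fun i => K.edgeLength i * m i)
    rw [Finset.card_univ, Fintype.card_fin] at h3
    refine h3.trans (mul_le_mul_of_nonneg_left (Finset.sum_le_sum fun i _ => ?_) (by positivity))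
    rw [mul_pow, pow_two (K.edgeLength i), mul_assoc, edgeIntegral]
    have hh := (K.edgeLength_pos i).le
    exact mul_le_mul_of_nonneg_left (mul_le_mul_of_nonneg_left (sq_integral_abs_le (hg i)) hh) hh
  calc (K.boundaryIntegral fun x => g x * w x) ^ 2
      = |K.boundaryIntegral fun x => g x * w x| ^ 2 := (sq_abs _).symm
    _ ≤ (4 * D * ∑ i, K.edgeLength i * m i) ^ 2 := pow_le_pow_left₀ (abs_nonneg _) h1 2
    _ = 16 * (D ^ 2 * (∑ i, K.edgeLength i * m i) ^ 2) := by ring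
    _ ≤ 16 * ((K.n * K.stab w w) *
          (K.n * ∑ i, K.edgeLength i * K.edgeIntegral i fun x => g x ^ 2)) := by
        have h4 := edgeVariation_sq_le (K := K) w
        exact mul_le_mul_of_nonneg_left
          (mul_le_mul h4 h2 (sq_nonneg _) ((sq_nonneg _).trans h4)) (by norm_num)
    _ = _ := by ring

end PolygonalElement

namespace PolygonalElement

variable {K : PolygonalElement}

/-! ### Green's formula for the slices -/

/-- Pythagoras for the energy projection: both mixed terms and the constant term equal `projEnergy v
w` up to sign, since `∇Πv` is the mean of `∇v`. -/
lemma integral_inner_weakGrad_slice {v w : Plane → ℝ} (hv : MemH1 K.carrier v)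
    (hw : MemH1 K.carrier w) (hvc : ContinuousOn v (closure K.carrier))
    (hwc : ContinuousOn w (closure K.carrier)) :
    ∫ x in K.carrier, inner ℝ (weakGrad K.carrier (K.slice v) x) (weakGrad K.carrier (K.slice w) x) =
      (∫ x in K.carrier, inner ℝ (weakGrad K.carrier v x) (weakGrad K.carrier w x)) -
        K.projEnergy v w := by
  have := K.isFiniteMeasure
  set a := gradient (K.proj v) 0 with ha
  set b := gradient (K.proj w) 0 with hb
  have hvi : Integrable (weakGrad K.carrier v) (volume.restrict K.carrier) :=
    hv.memLp_weakGrad.integrable (by norm_num)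
  have hwi : Integrable (weakGrad K.carrier w) (volume.restrict K.carrier) :=
    hw.memLp_weakGrad.integrable (by norm_num)
  have h1 : ∫ x in K.carrier,
      inner ℝ (weakGrad K.carrier (K.slice v) x) (weakGrad K.carrier (K.slice w) x) =
      ∫ x in K.carrier, (inner ℝ (weakGrad K.carrier v x) (weakGrad K.carrier w x) -
        inner ℝ b (weakGrad K.carrier v x) - inner ℝ a (weakGrad K.carrier w x) + inner ℝ a b) := by
    refine integral_congr_ae ?_
    filter_upwards [(isWeakGradient_slice hv).weakGrad_ae_eq K.isOpen,
      (isWeakGradient_slice hw).weakGrad_ae_eq K.isOpen] with x hx hy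
    rw [hx, hy, ← ha, ← hb]
    simp only [inner_sub_left, inner_sub_right, real_inner_comm b]
    ring
  have hvw := integrable_inner_of_memLp_two hv.memLp_weakGrad hw.memLp_weakGrad
  have hbv := hvi.const_inner (𝕜 := ℝ) b
  have haw := hwi.const_inner (𝕜 := ℝ) a
  have hs : Integrable (fun x => inner ℝ (weakGrad K.carrier v x) (weakGrad K.carrier w x) -
      inner ℝ b (weakGrad K.carrier v x)) (volume.restrict K.carrier) := hvw.sub hbv
  have hs' : Integrable (fun x => inner ℝ (weakGrad K.carrier v x) (weakGrad K.carrier w x) -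
      inner ℝ b (weakGrad K.carrier v x) - inner ℝ a (weakGrad K.carrier w x))
      (volume.restrict K.carrier) := hs.sub haw
  rw [h1, integral_add hs' (integrable_const _), integral_sub hs haw, integral_sub hvw hbv, integral_inner hvi, integral_inner hwi,
    integral_weakGrad hv hvc, integral_weakGrad hw hwc, ← ha, ← hb, setIntegral_const,
    projEnergy_eq, ← ha, ← hb, inner_smul_right, inner_smul_right, real_inner_comm a b, smul_eq_mul]
  ring

lemma integral_fderiv_test {φ : Plane → ℝ} (hφ : IsTestFunction K.carrier φ) (a : Plane) :
    ∫ x in K.carrier, fderiv ℝ φ x a = 0 := by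
  obtain ⟨q, hq, hq'⟩ := exists_affine 0 1
  -- The constant function 1 has weak gradient zero.
  have := (isWeakGradient_affine (K := K) q).2.2 φ hφ a
  simpa [hq, hq'] using this

lemma boundaryIntegral_mul_test (g : Plane → ℝ) {φ : Plane → ℝ}
    (hφ : IsTestFunction K.carrier φ) : K.boundaryIntegral (fun x => g x * φ x) = 0 := by
  refine Finset.sum_eq_zero fun i _ => ?_
  rw [edgeIntegral, intervalIntegral.integral_congr (g := fun _ => 0) fun t ht => ?_]
  · simp
  · rw [Set.uIcc_of_le zero_le_one] at ht
    simp [hφ.eq_zero (K.edgePath_notMem i ht)]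

variable {Ω : Set Plane} {f u : Plane → ℝ}

/-- The equation `-Δu = f` localizes to `K`, because a test function on `K` is also one on `Ω`. -/
lemma integral_inner_weakGrad_test (hΩ : IsOpen Ω) (hK : K.carrier ⊆ Ω)
    (hu : IsWeakSolution Ω f u) {φ : Plane → ℝ} (hφ : IsTestFunction K.carrier φ) :
    ∫ x in K.carrier, inner ℝ (weakGrad K.carrier u x) (gradient φ x) =
      ∫ x in K.carrier, f x * φ x := by
  have h1 := hu.2 φ ((hφ.mono hK).memH10 hΩ)
  have h2 : ∫ x in Ω, inner ℝ (weakGrad Ω u x) (weakGrad Ω φ x) =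
      ∫ x in Ω, inner ℝ (weakGrad Ω u x) (gradient φ x) := by
    refine integral_congr_ae ?_
    filter_upwards [(hφ.isWeakGradient (U := Ω)).weakGrad_ae_eq hΩ] with x hx
    rw [hx]
  have h3 : ∫ x in K.carrier, inner ℝ (weakGrad K.carrier u x) (gradient φ x) =
      ∫ x in K.carrier, inner ℝ (weakGrad Ω u x) (gradient φ x) := by
    refine integral_congr_ae ?_
    filter_upwards [weakGrad_mono hΩ K.isOpen hK hu.1.1] with x hx
    rw [hx]
  rw [h3, ← setIntegral_eq_of_subset_of_forall_sdiff_eq_zero hΩ.measurableSet hK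
      (fun x hx => by simp [gradient, hφ.fderiv_eq_zero hx.2]),
    ← setIntegral_eq_of_subset_of_forall_sdiff_eq_zero hΩ.measurableSet hK
      (fun x hx => by simp [hφ.eq_zero hx.2]), ← h2, h1]

/-- The final bracket is the local residual of the weak formulation; it need not vanish on a single
element, only after summation over the mesh. -/
lemma integral_mul_proj_eq (hΩ : IsOpen Ω) (hK : K.carrier ⊆ Ω)
    (hf : MemLp f 2 (volume.restrict Ω)) (hu : IsWeakSolution Ω f u)
    (huc : ContinuousOn u (closure Ω)) {g : Plane → ℝ}
    (hg : K.IsNormalDerivative (K.slice u) g) {v : Plane → ℝ} (hv : MemH1 K.carrier v)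
    (hvc : ContinuousOn v (closure K.carrier)) :
    ∫ x in K.carrier, f x * K.proj v x =
      K.projEnergy u v + K.boundaryIntegral (fun x => g x * K.slice v x) +
        ((∫ x in K.carrier, f x * v x) -
          ∫ x in K.carrier, inner ℝ (weakGrad K.carrier u x) (weakGrad K.carrier v x)) := by
  have := K.isFiniteMeasure
  obtain ⟨-, -, d, hd, hgreen⟩ := hg
  have huK : MemH1 K.carrier u := hu.1.1.mono hΩ hK
  have hucK : ContinuousOn u (closure K.carrier) := huc.mono (closure_mono hK)
  have hfK : MemLp f 2 (volume.restrict K.carrier) :=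
    hf.mono_measure (Measure.restrict_mono hK le_rfl)
  -- Test functions kill the boundary term and the constant vector `∇Πu`, leaving the local equation
  -- for `u`.
  have hdf : d =ᵐ[volume.restrict K.carrier] -f := by
    refine IsWeakGradient.ae_eq_of_forall_integral_test K.isOpen hd hfK.neg fun φ hφ => ?_
    have hφw := hφ.isWeakGradient (U := K.carrier)
    have h1 := hgreen φ hφw.memH1 hφ.continuous.continuousOn
    have h2 : ∫ x in K.carrier,
        inner ℝ (weakGrad K.carrier (K.slice u) x) (weakGrad K.carrier φ x) =
        ∫ x in K.carrier, (inner ℝ (weakGrad K.carrier u x) (gradient φ x) -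
          fderiv ℝ φ x (gradient (K.proj u) 0)) := by
      refine integral_congr_ae ?_
      filter_upwards [(isWeakGradient_slice huK).weakGrad_ae_eq K.isOpen,
        hφw.weakGrad_ae_eq K.isOpen] with x hx hy
      rw [hx, hy, inner_sub_left, real_inner_comm _ (gradient (K.proj u) 0), inner_gradient]
    rw [boundaryIntegral_mul_test g hφ, h2, integral_sub
      (integrable_inner_of_memLp_two huK.memLp_weakGrad (hφ.memLp_gradient _))
      ((hφ.memLp_fderiv _ _).integrable (by norm_num)), integral_fderiv_test hφ,
      integral_inner_weakGrad_test hΩ hK hu hφ] at h1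
    simp only [Pi.neg_apply, neg_mul, integral_neg]
    linarith
  have h1 := hgreen (K.slice v) (isWeakGradient_slice hv).memH1 (continuousOn_slice hvc)
  have h2 : ∫ x in K.carrier, d x * K.slice v x =
      ∫ x in K.carrier, (f x * K.proj v x - f x * v x) := by
    refine integral_congr_ae ?_
    filter_upwards [hdf] with x hx
    rw [hx, slice, Pi.neg_apply]
    ring
  rw [integral_inner_weakGrad_slice huK hv hucK hvc, h2, integral_sub
    (integrable_mul_of_memLp_two hfK (memLp_affine _))
    (integrable_mul_of_memLp_two hfK hv.memLp)] at h1
  linarith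

/-! ### Bilinearity and Cauchy-Schwarz estimates -/

lemma projEnergy_sub_left {v w : Plane → ℝ} (hv : MemH1 K.carrier v) (hw : MemH1 K.carrier w)
    (hvc : ContinuousOn v (closure K.carrier)) (hwc : ContinuousOn w (closure K.carrier))
    (z : Plane → ℝ) :
    K.projEnergy (fun x => v x - w x) z = K.projEnergy v z - K.projEnergy w z := by
  simp only [projEnergy_eq, proj_sub hv hw hvc hwc, gradient_affine_sub, inner_sub_left, mul_sub]

lemma stab_slice_sub_left {v w : Plane → ℝ} (hv : MemH1 K.carrier v) (hw : MemH1 K.carrier w)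
    (hvc : ContinuousOn v (closure K.carrier)) (hwc : ContinuousOn w (closure K.carrier))
    (z : Plane → ℝ) :
    K.stab (K.slice fun x => v x - w x) z = K.stab (K.slice v) z - K.stab (K.slice w) z := by
  simp only [stab, slice_sub hv hw hvc hwc, ← Finset.sum_sub_distrib]
  exact Finset.sum_congr rfl fun i _ => by ring

lemma projEnergy_le (v w : Plane → ℝ) :
    K.projEnergy v w ≤ (K.projEnergy v v + K.projEnergy w w) / 2 := by
  simp only [projEnergy_eq]
  have h := real_inner_self_nonneg (x := gradient (K.proj v) 0 - gradient (K.proj w) 0)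
  rw [real_inner_sub_sub_self] at h
  have := mul_nonneg K.volume_real_pos.le h
  linarith

lemma projEnergy_self_nonneg (v : Plane → ℝ) : 0 ≤ K.projEnergy v v := by
  rw [projEnergy_eq]
  exact mul_nonneg K.volume_real_pos.le real_inner_self_nonneg

lemma stab_self_nonneg (v : Plane → ℝ) : 0 ≤ K.stab v v :=
  Finset.sum_nonneg fun _ _ => mul_self_nonneg _

/-- The weight 1/4 matches `boundaryIntegral_mul_slice_le`, so that together they use up half of the
stabilization of the error. -/
lemma neg_stab_le (v w : Plane → ℝ) : -K.stab v w ≤ K.stab v v + K.stab w w / 4 := by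
  rw [stab, stab, stab, ← Finset.sum_neg_distrib, Finset.sum_div, ← Finset.sum_add_distrib]
  refine Finset.sum_le_sum fun i _ => ?_
  nlinarith [sq_nonneg ((v (K.edgeEnd i) - v (K.edgeStart i)) +
    (w (K.edgeEnd i) - w (K.edgeStart i)) / 2)]

lemma sum_edgeIntegral_sq_nonneg (g : Plane → ℝ) :
    0 ≤ ∑ i, K.edgeLength i * K.edgeIntegral i fun x => g x ^ 2 :=
  Finset.sum_nonneg fun i _ => mul_nonneg (K.edgeLength_pos i).le
    (mul_nonneg (K.edgeLength_pos i).le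
      (intervalIntegral.integral_nonneg zero_le_one fun _ _ => sq_nonneg _))

lemma MemVK.sub {v w : Plane → ℝ} (hv : K.MemVK v) (hw : K.MemVK w) :
    K.MemVK (fun x => v x - w x) :=
  ⟨hv.1.sub hw.1, hv.2.1.sub hw.2.1, hv.2.2.1.sub hw.2.2.1, fun i t ht => by
    simp only [hv.2.2.2 i t ht, hw.2.2.2 i t ht]; ring⟩

lemma boundaryIntegral_mul_slice_le {g v : Plane → ℝ} (hg : K.MemL2Boundary g) (hv : K.MemVK v) :
    K.boundaryIntegral (fun x => g x * K.slice v x) ≤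
      K.stab (K.slice v) (K.slice v) / 4 +
        16 * ((K.n : ℝ) ^ 2 * ∑ i, K.edgeLength i * K.edgeIntegral i fun x => g x ^ 2) := by
  have h1 := sq_boundaryIntegral_mul_le hg (IsEdgewiseAffine.slice hv.2.2.2)
    (continuousOn_slice hv.2.2.1) (boundaryIntegral_slice hv.1 hv.2.2.1)
  have h2 := stab_self_nonneg (K := K) (K.slice v)
  have h3 := mul_nonneg (sq_nonneg (K.n : ℝ)) (sum_edgeIntegral_sq_nonneg (K := K) g)
  refine le_of_sq_le_sq ?_ (by positivity)
  refine h1.trans ?_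
  set s := K.stab (K.slice v) (K.slice v)
  set y := (K.n : ℝ) ^ 2 * ∑ i, K.edgeLength i * K.edgeIntegral i fun x => g x ^ 2
  -- The square gives `(s/4 + 16y)² ≥ 16sy`.
  nlinarith [sq_nonneg (s / 4 - 16 * y)]

end PolygonalElement

/-! ### Summation over the mesh and the error identity. -/

namespace PolygonalMesh

variable {Ω : Set Plane} (T : PolygonalMesh Ω)

/-- The closures cover `Ω`, so what the open elements miss lies on finitely many null frontiers. -/
lemma ae_eq_iUnion : Ω =ᵐ[volume] ⋃ k, (T.elem k).carrier := by
  refine (ae_le_set.2 (measure_mono_null ?_ (measure_iUnion_null fun k =>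
    (T.elem k).volume_frontier))).antisymm
      (Set.iUnion_subset T.subset : (⋃ k, (T.elem k).carrier) ⊆ Ω).eventuallyLE
  rintro x ⟨hx, hx'⟩
  have h1 : x ∈ ⋃ k, closure (T.elem k).carrier := T.cover ▸ subset_closure hx
  obtain ⟨k, hk⟩ := Set.mem_iUnion.1 h1
  refine Set.mem_iUnion.2 ⟨k, ?_⟩
  rw [(T.elem k).isOpen.frontier_eq]
  exact ⟨hk, fun h => hx' (Set.mem_iUnion.2 ⟨k, h⟩)⟩

lemma sum_setIntegral {F : Plane → ℝ} (hF : IntegrableOn F Ω) :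
    ∑ k, ∫ x in (T.elem k).carrier, F x = ∫ x in Ω, F x := by
  rw [setIntegral_congr_set T.ae_eq_iUnion]
  exact (integral_iUnion_fintype (fun k => (T.elem k).isOpen.measurableSet)
    (fun k l h => T.disjoint k l h) fun k => hF.mono_set (T.subset k)).symm

variable {T} {f u : Plane → ℝ} {g : Fin T.N → Plane → ℝ}

lemma MemVh.sub (hΩ : IsOpen Ω) {v w : Plane → ℝ} (hv : T.MemVh v) (hw : T.MemVh w) :
    T.MemVh (fun x => v x - w x) :=
  ⟨hv.1.sub hΩ hw.1, fun k => (hv.2 k).sub (hw.2 k)⟩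

lemma sum_integral_mul_proj_eq (hΩ : IsOpen Ω) (hf : MemLp f 2 (volume.restrict Ω))
    (hu : IsWeakSolution Ω f u) (huc : ContinuousOn u (closure Ω))
    (hg : ∀ k, (T.elem k).IsNormalDerivative ((T.elem k).slice u) (g k)) {v : Plane → ℝ}
    (hv : T.MemVh v) :
    ∑ k, ∫ x in (T.elem k).carrier, f x * (T.elem k).proj v x =
      ∑ k, ((T.elem k).projEnergy u v +
        (T.elem k).boundaryIntegral (fun x => g k x * (T.elem k).slice v x)) := by
  have h1 : ∀ k, ∫ x in (T.elem k).carrier, inner ℝ (weakGrad (T.elem k).carrier u x)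
      (weakGrad (T.elem k).carrier v x) =
      ∫ x in (T.elem k).carrier, inner ℝ (weakGrad Ω u x) (weakGrad Ω v x) := fun k => by
    refine integral_congr_ae ?_
    filter_upwards [weakGrad_mono hΩ (T.elem k).isOpen (T.subset k) hu.1.1,
      weakGrad_mono hΩ (T.elem k).isOpen (T.subset k) hv.1.1] with x hx hy
    rw [hx, hy]
  rw [Finset.sum_congr rfl fun k _ => PolygonalElement.integral_mul_proj_eq hΩ (T.subset k) hf hu
    huc (hg k) (hv.2 k).1 (hv.2 k).2.2.1]
  simp only [h1]
  rw [Finset.sum_add_distrib, Finset.sum_sub_distrib, T.sum_setIntegral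
    (integrable_mul_of_memLp_two hf hv.1.1.memLp), T.sum_setIntegral
    (integrable_inner_of_memLp_two hu.1.1.memLp_weakGrad hv.1.1.memLp_weakGrad), hu.2 v hv.1,
    sub_self, add_zero]

lemma ah_sub_self_eq (hΩ : IsOpen Ω) (hf : MemLp f 2 (volume.restrict Ω))
    (hu : IsWeakSolution Ω f u) (huc : ContinuousOn u (closure Ω))
    (hg : ∀ k, (T.elem k).IsNormalDerivative ((T.elem k).slice u) (g k)) {uI uh : Plane → ℝ}
    (hI : T.MemVh uI) (hh : T.IsVEMSolution f uh) :
    T.ah (fun x => uh x - uI x) (fun x => uh x - uI x) =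
      ∑ k, ((T.elem k).projEnergy (fun x => u x - uI x) (fun x => uh x - uI x) +
        (T.elem k).boundaryIntegral
          (fun x => g k x * (T.elem k).slice (fun x => uh x - uI x) x) -
        (T.elem k).stab ((T.elem k).slice uI) ((T.elem k).slice fun x => uh x - uI x)) := by
  have hv : T.MemVh (fun x => uh x - uI x) := hh.1.sub hΩ hI
  have h1 := (hh.2 _ hv).trans (sum_integral_mul_proj_eq hΩ hf hu huc hg hv)
  rw [ah, ← Finset.sum_add_distrib] at h1 ⊢
  have hl : ∀ k, (T.elem k).projEnergy (fun x => uh x - uI x) (fun x => uh x - uI x) =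
      (T.elem k).projEnergy uh (fun x => uh x - uI x) -
        (T.elem k).projEnergy uI (fun x => uh x - uI x) := fun k =>
    PolygonalElement.projEnergy_sub_left (hh.1.2 k).1 (hI.2 k).1 (hh.1.2 k).2.2.1
      (hI.2 k).2.2.1 _
  have hs : ∀ k, (T.elem k).stab ((T.elem k).slice fun x => uh x - uI x)
      ((T.elem k).slice fun x => uh x - uI x) =
      (T.elem k).stab ((T.elem k).slice uh) ((T.elem k).slice fun x => uh x - uI x) -
        (T.elem k).stab ((T.elem k).slice uI) ((T.elem k).slice fun x => uh x - uI x) := fun k =>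
    PolygonalElement.stab_slice_sub_left (hh.1.2 k).1 (hI.2 k).1 (hh.1.2 k).2.2.1
      (hI.2 k).2.2.1 _
  have hr : ∀ k, (T.elem k).projEnergy (fun x => u x - uI x) (fun x => uh x - uI x) =
      (T.elem k).projEnergy u (fun x => uh x - uI x) -
        (T.elem k).projEnergy uI (fun x => uh x - uI x) := fun k =>
    PolygonalElement.projEnergy_sub_left (hu.1.1.mono hΩ (T.subset k)) (hI.2 k).1
      (huc.mono (closure_mono (T.subset k))) (hI.2 k).2.2.1 _
  simp only [hl, hs, hr]
  simp only [Finset.sum_add_distrib, Finset.sum_sub_distrib] at h1 ⊢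
  linarith

end PolygonalMesh

end VEM

/-- The a priori error bound, with one absolute constant `C`. The function `g k` is the normal
derivative `∇(u - Πu) · n` on the boundary of the `k`-th element. -/
theorem corollary2p4 :
    ∃ C : ℝ, 0 < C ∧
      ∀ (Ω : Set VEM.Plane), IsOpen Ω → Bornology.IsBounded Ω →
      ∀ (T : VEM.PolygonalMesh Ω) (f u uI uh : VEM.Plane → ℝ)
        (g : Fin T.N → VEM.Plane → ℝ),
        MemLp f 2 (volume.restrict Ω) →
        VEM.IsWeakSolution Ω f u →
        ContinuousOn u (closure Ω) →
        T.IsNodalInterpolation u uI →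
        T.IsVEMSolution f uh →
        (∀ k, (T.elem k).IsNormalDerivative ((T.elem k).slice u) (g k)) →
        T.tripleNorm (fun x => uh x - uI x) ≤
          C * √(∑ k, ((T.elem k).projEnergy (fun x => u x - uI x) (fun x => u x - uI x)
              + (T.elem k).stab ((T.elem k).slice uI) ((T.elem k).slice uI)
              + ((T.elem k).n : ℝ) ^ 2 *
                ∑ i, (T.elem k).edgeLength i *
                  (T.elem k).edgeIntegral i (fun x => g k x ^ 2))) := by
  -- Absorption doubles the factor 18 obtained below, and `6 = √36`; the local coefficients are 1/2,
  -- 1 and 16, with 16 rounded up to 18 to reach a perfect square.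
  refine ⟨6, by norm_num, fun Ω hΩ _ T f u uI uh g hf hu huc hI hh hg => ?_⟩
  have hv : T.MemVh (fun x => uh x - uI x) := hh.1.sub hΩ hI.1
  rw [show (6 : ℝ) = √36 by rw [show (36 : ℝ) = 6 ^ 2 by norm_num, Real.sqrt_sq (by norm_num)],
    ← Real.sqrt_mul (by norm_num), VEM.PolygonalMesh.tripleNorm]
  refine Real.sqrt_le_sqrt ?_
  have h2 := VEM.PolygonalMesh.ah_sub_self_eq hΩ hf hu huc hg hI.1 hh
  rw [VEM.PolygonalMesh.ah, ← Finset.sum_add_distrib] at h2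
  rw [VEM.PolygonalMesh.ah, ← Finset.sum_add_distrib, Finset.mul_sum]
  have h3 : ∑ k, ((T.elem k).projEnergy (fun x => uh x - uI x) (fun x => uh x - uI x) +
      (T.elem k).stab ((T.elem k).slice fun x => uh x - uI x)
        ((T.elem k).slice fun x => uh x - uI x)) ≤
      ∑ k, ((18 * ((T.elem k).projEnergy (fun x => u x - uI x) (fun x => u x - uI x)
              + (T.elem k).stab ((T.elem k).slice uI) ((T.elem k).slice uI)
              + ((T.elem k).n : ℝ) ^ 2 *
                ∑ i, (T.elem k).edgeLength i *
                  (T.elem k).edgeIntegral i (fun x => g k x ^ 2))) +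
        ((T.elem k).projEnergy (fun x => uh x - uI x) (fun x => uh x - uI x) +
          (T.elem k).stab ((T.elem k).slice fun x => uh x - uI x)
            ((T.elem k).slice fun x => uh x - uI x)) / 2) := by
    rw [h2]
    refine Finset.sum_le_sum fun k _ => ?_
    have a1 := VEM.PolygonalElement.projEnergy_le (K := T.elem k)
      (fun x => u x - uI x) (fun x => uh x - uI x)
    have a2 := VEM.PolygonalElement.boundaryIntegral_mul_slice_le (hg k).2.1 (hv.2 k)
    have a3 := VEM.PolygonalElement.neg_stab_le (K := T.elem k) ((T.elem k).slice uI)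
      ((T.elem k).slice fun x => uh x - uI x)
    have b1 := VEM.PolygonalElement.projEnergy_self_nonneg (K := T.elem k) (fun x => u x - uI x)
    have b2 := VEM.PolygonalElement.stab_self_nonneg (K := T.elem k) ((T.elem k).slice uI)
    have b3 := mul_nonneg (sq_nonneg ((T.elem k).n : ℝ))
      (VEM.PolygonalElement.sum_edgeIntegral_sq_nonneg (K := T.elem k) (g k))
    linarith
  -- `h3` has the form `A ≤ 18 R + A / 2`, hence `A ≤ 36 R`.
  simp only [Finset.sum_add_distrib, ← Finset.sum_div, ← Finset.mul_sum] at h3 ⊢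
  linarith
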